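/- Let $G$ be a finite simple graph. A set $D\subseteq V(G)$ is a dominating set of $G$ if every vertex of $V(G)\setminus D$ is adjacent to at least one vertex of $D$. The TARS-graph $\varepsilon(G)$ is the simple graph whose vertices are the dominating sets of $G$, where two dominating sets $X$ and $Y$ are adjacent if and only if either (i) $Y$ can be obtained from $X$ by adding or deleting a single vertex of $G$, or (ii) there are vertices $u\in X$ and $v\in Y\setminus X$ that are adjacent in $G$ such that $Y=(X\cup\{v\})\setminus\{u\}$. A finite graph on $n$ vertices is pancyclic if it contains a cycle of length $\ell$ for every integer $\ell$ with $3\le \ell\le n$. Corollary (forests). If $F$ is a finite forest (a finite acyclic simple graph), then $\varepsilon(F)$ is pancyclic. -/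

import Mathlib

namespace SimpleGraph

variable {V : Type*}

/-- `S` is a dominating set of `G`: every vertex lies in `S` or has a neighbour in `S`. -/
def IsDominatingSet (G : SimpleGraph V) (S : Set V) : Prop :=
  ∀ w : V, w ∈ S ∨ ∃ s ∈ S, G.Adj w s

/-- Token addition/removal: `Y` arises from `X` by adding or deleting a single vertex. -/
def TokenAddRemove (X Y : Set V) : Prop :=
  (∃ v, v ∉ X ∧ Y = X ∪ {v}) ∨ (∃ v, v ∈ X ∧ Y = X \ {v})

/-- Token sliding: `Y` arises from `X` by moving one token along an edge of `G`. -/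
def TokenSlide (G : SimpleGraph V) (X Y : Set V) : Prop :=
  ∃ u ∈ X, ∃ v ∈ Y \ X, G.Adj u v ∧ Y = (X ∪ {v}) \ {u}

theorem TokenAddRemove.symm {X Y : Set V} (h : TokenAddRemove X Y) : TokenAddRemove Y X := by
  rcases h with ⟨v, hv, rfl⟩ | ⟨v, hv, rfl⟩
  · refine Or.inr ⟨v, Or.inr rfl, ?_⟩
    ext w
    by_cases hw : w = v
    · subst hw; simp [hv]
    · simp [hw]
  · refine Or.inl ⟨v, by simp, ?_⟩
    ext w
    by_cases hw : w = v
    · subst hw; simp [hv]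
    · simp [hw]

theorem TokenSlide.symm {G : SimpleGraph V} {X Y : Set V} (h : TokenSlide G X Y) :
    TokenSlide G Y X := by
  obtain ⟨u, hu, v, ⟨hvY, hvX⟩, huv, rfl⟩ := h
  refine ⟨v, hvY, u, ⟨hu, by simp⟩, huv.symm, ?_⟩
  ext w
  by_cases hw : w = u
  · subst hw; simp [hu, huv.ne]
  · by_cases hw' : w = v
    · subst hw'; simp [hvX, hw]
    · simp [hw, hw']

theorem TokenAddRemove.ne {X Y : Set V} (h : TokenAddRemove X Y) : X ≠ Y := by
  rintro rfl
  rcases h with ⟨v, hv, h⟩ | ⟨v, hv, h⟩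
  · exact hv (h ▸ Or.inr rfl)
  · rw [h] at hv
    exact hv.2 rfl

theorem TokenSlide.ne {G : SimpleGraph V} {X Y : Set V} (h : TokenSlide G X Y) : X ≠ Y := by
  rintro rfl
  obtain ⟨_, _, _, ⟨hv, hv'⟩, _⟩ := h
  exact hv' hv

/-- The TARS-graph of `G`: its vertices are the dominating sets of `G`, and two of them are adjacent
if they differ by a token addition/removal or by a token slide along an edge of `G`. -/
def tarsGraph (G : SimpleGraph V) : SimpleGraph {S : Set V // G.IsDominatingSet S} where
  Adj X Y := TokenAddRemove X.1 Y.1 ∨ TokenSlide G X.1 Y.1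
  symm := ⟨fun _ _ h => h.imp TokenAddRemove.symm TokenSlide.symm⟩
  loopless := ⟨fun _ h => h.elim (fun h => h.ne rfl) (fun h => h.ne rfl)⟩

/-- A finite graph on `n` vertices is pancyclic if it has a cycle of each length `3 ≤ ℓ ≤ n`. -/
def IsPancyclic [Finite V] (G : SimpleGraph V) : Prop :=
  ∀ ℓ : ℕ, 3 ≤ ℓ → ℓ ≤ Nat.card V → ∃ (v : V) (c : G.Walk v v), c.IsCycle ∧ c.length = ℓ

end SimpleGraph

/-! Induction on vertex sets `W` of the forest, deleting a leaf `v` together with its neighbour `u`.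
`baseSet` maps the dominating sets of `W` to those of `W \ {u, v}`. The fibre over `b` consists of
`b ∪ {v}` and of all `S ∪ {u}` and `S ∪ {u, v}`, where `S` arises from `b` by removing detachable
vertices (`fibre_eq`). These `S` form a cube, so a Gray code turns the sets containing `u` into a
prism over a path, with `b ∪ {v}` attached at its first rung. Every fibre has odd size.

If the base has a Hamiltonian path with an odd number of vertices, the copies `b ∪ {u}`, `b ∪ {u,
v}`, `b ∪ {v}` give three parallel rails over it. Threading along the rails yields paths with
adjacent ends on every number of vertices from 2 to the maximum (`LadderFibration.hasPathOn`). The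
longest one is Hamiltonian and, as an odd sum of odd numbers, again odd, so the induction continues
(`IsAcyclic.exists_hamiltonian_list`). Over all of `V`, joining the two ends gives the cycles. -/

namespace SimpleGraph

/-! ### Paths with a prescribed number of vertices, and prisms -/

variable {α β : Type*} {G : SimpleGraph α} {a b c d : α} {A B : Set α} {m n : ℕ}

/-- There is a path from `a` to `b` on exactly `n` vertices, all of them in `A`. -/
def HasPathOn (G : SimpleGraph α) (a b : α) (A : Set α) (n : ℕ) : Prop :=
  ∃ p : G.Walk a b, p.IsPath ∧ p.length + 1 = n ∧ ∀ s ∈ p.support, s ∈ A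

theorem HasPathOn.mono (h : G.HasPathOn a b A n) (hAB : A ⊆ B) : G.HasPathOn a b B n := by
  obtain ⟨p, hp, hn, hA⟩ := h
  exact ⟨p, hp, hn, fun s hs => hAB (hA s hs)⟩

theorem hasPathOn_singleton (G : SimpleGraph α) (a : α) : G.HasPathOn a a {a} 1 :=
  ⟨.nil, by simp, by simp, by simp⟩

theorem HasPathOn.symm (h : G.HasPathOn a b A n) : G.HasPathOn b a A n := by
  obtain ⟨p, hp, hn, hA⟩ := h
  exact ⟨p.reverse, hp.reverse, by simpa using hn, by simpa using hA⟩

theorem HasPathOn.append (h : G.HasPathOn a b A n) (hbc : G.Adj b c) (h' : G.HasPathOn c d B m)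
    (hAB : ∀ s ∈ A, s ∉ B) : G.HasPathOn a d (A ∪ B) (n + m) := by
  obtain ⟨p, hp, hn, hA⟩ := h
  obtain ⟨q, hq, hm, hB⟩ := h'
  have hs : (p.append (.cons hbc q)).support = p.support ++ q.support := by
    simp [Walk.support_append]
  refine ⟨p.append (.cons hbc q), ?_, ?_, ?_⟩
  · rw [Walk.isPath_def, hs, List.nodup_append]
    refine ⟨hp.support_nodup, hq.support_nodup, ?_⟩
    rintro s hsp _ hsq rfl
    exact hAB s (hA s hsp) (hB s hsq)
  · simp only [Walk.length_append, Walk.length_cons]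
    omega
  · intro s
    rw [hs, List.mem_append]
    exact Or.imp (hA s) (hB s)

theorem HasPathOn.cons (hab : G.Adj a b) (h : G.HasPathOn b c A n) (ha : a ∉ A) :
    G.HasPathOn a c (insert a A) (n + 1) := by
  rw [add_comm, Set.insert_eq]
  exact (G.hasPathOn_singleton a).append hab h (by simpa using ha)

theorem HasPathOn.concat (h : G.HasPathOn a b A n) (hbc : G.Adj b c) (hc : c ∉ A) :
    G.HasPathOn a c (insert c A) (n + 1) :=
  (h.symm.cons hbc.symm hc).symm

/-- In a prism over a path, the two ends of the first rung are joined by paths on all even numbers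
of vertices; here the last vertex of such a path is left out. -/
theorem exists_hasPathOn_prism {x y : β → α} {P : Set β} (hxy : ∀ s ∈ P, ∀ t ∈ P, x s ≠ y t)
    (hx : P.InjOn x) (hy : P.InjOn y) (hadj : ∀ t ∈ P, G.Adj (x t) (y t)) (j : ℕ) :
    ∀ (s : β) (l : List β), (s :: l).Nodup → (∀ t ∈ s :: l, t ∈ P) →
      (s :: l).IsChain (fun t t' => G.Adj (x t) (x t') ∧ G.Adj (y t) (y t')) →
      j ≤ l.length →
      ∃ c, G.Adj c (y s) ∧ (c = x s ∨ ∃ t l', l = t :: l' ∧ c = y t) ∧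
        G.HasPathOn (x s) c {D | ∃ t ∈ s :: l, D = x t ∨ D = y t ∧ t ≠ s} (2 * j + 1) := by
  induction j with
  | zero =>
    intro s l _ hP _ _
    refine ⟨x s, hadj s (hP s (by simp)), Or.inl rfl, (G.hasPathOn_singleton _).mono ?_⟩
    rintro _ rfl
    exact ⟨s, by simp, Or.inl rfl⟩
  | succ j ih =>
    rintro s (_ | ⟨t, l⟩) hnd hP hch hj
    · simp at hj
    rw [List.isChain_cons_cons] at hch
    have hP' : ∀ t' ∈ t :: l, t' ∈ P := fun t' ht' => hP t' (List.mem_cons_of_mem _ ht')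
    have hs : s ∈ P := hP s (by simp)
    have ht : t ∈ P := hP' t (by simp)
    obtain ⟨c, hc, -, hp⟩ := ih t l hnd.of_cons hP' hch.2 (by simpa using hj)
    have hst : ∀ t' ∈ t :: l, t' ≠ s := by
      rintro t' ht' rfl
      exact (List.nodup_cons.1 hnd).1 ht'
    -- The path is `x s`, then the path of the shorter prism from `x t` to `c`, then `y t`, which
    -- that path had left out.
    refine ⟨y t, hch.1.2.symm, Or.inr ⟨t, l, rfl, rfl⟩,
      ((hp.concat hc ?_).cons hch.1.1 ?_).mono ?_⟩
    · rintro ⟨t', ht', h | ⟨h, h'⟩⟩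
      · exact hxy _ (hP' _ ht') _ ht h.symm
      · exact h' (hy ht (hP' _ ht') h).symm
    · rintro (h | ⟨t', ht', h | ⟨h, -⟩⟩)
      · exact hxy _ hs _ ht h
      · exact hst _ ht' (hx hs (hP' _ ht') h).symm
      · exact hxy _ hs _ (hP' _ ht') h
    · rintro D (rfl | rfl | ⟨t', ht', h⟩)
      · exact ⟨s, by simp, Or.inl rfl⟩
      · exact ⟨t, by simp, Or.inr ⟨rfl, hst t (by simp)⟩⟩
      · exact ⟨t', List.mem_cons_of_mem _ ht', h.imp_right fun h => ⟨h.1, hst _ ht'⟩⟩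

/-! ### Threading paths through a ladder fibration -/

/-- Data for threading paths through a graph `G` fibred by `π` over a graph `H`: the fibre over `b`
contains a triangle `x b`, `y b`, `z b`, and for `1 ≤ j ≤ r b` a path on `2 * j - 1` vertices from
`x b` to a common neighbour of `y b` and `z b`. -/
structure LadderFibration (G : SimpleGraph α) (H : SimpleGraph β) (X : Set α) (P : Set β)
    (π : α → β) (x y z : β → α) (r : β → ℕ) : Prop where
  x_mem : ∀ b ∈ P, x b ∈ X ∧ π (x b) = b
  y_mem : ∀ b ∈ P, y b ∈ X ∧ π (y b) = b
  z_mem : ∀ b ∈ P, z b ∈ X ∧ π (z b) = b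
  x_adj_y : ∀ b ∈ P, G.Adj (x b) (y b)
  x_adj_z : ∀ b ∈ P, G.Adj (x b) (z b)
  z_adj_y : ∀ b ∈ P, G.Adj (z b) (y b)
  x_adj_x : ∀ b ∈ P, ∀ b' ∈ P, H.Adj b b' → G.Adj (x b) (x b')
  y_adj_y : ∀ b ∈ P, ∀ b' ∈ P, H.Adj b b' → G.Adj (y b) (y b')
  z_adj_z : ∀ b ∈ P, ∀ b' ∈ P, H.Adj b b' → G.Adj (z b) (z b')
  one_le : ∀ b ∈ P, 1 ≤ r b
  path : ∀ b ∈ P, ∀ j, 1 ≤ j → j ≤ r b → ∃ c, G.Adj c (y b) ∧ G.Adj c (z b) ∧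
    G.HasPathOn (x b) c {D | D ∈ X ∧ π D = b ∧ D ≠ y b ∧ D ≠ z b} (2 * j - 1)

namespace LadderFibration

variable {H : SimpleGraph β} {X : Set α} {P : Set β} {π : α → β} {x y z : β → α} {r : β → ℕ}

theorem hasPathOn_fibre (h : LadderFibration G H X P π x y z r) {b : β} (hb : b ∈ P) {n : ℕ}
    (hn : 2 ≤ n) (hn' : n ≤ 2 * r b + 1) :
    G.HasPathOn (x b) (y b) {D | D ∈ X ∧ π D = b} n := by
  obtain ⟨j, rfl | rfl⟩ := n.even_or_odd'
  -- An even number of vertices skips `z b`; an odd number inserts it between `c` and `y b`.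
  · obtain ⟨c, hcy, -, hp⟩ := h.path b hb j (by omega) (by omega)
    have := hp.concat hcy (by simp)
    rw [show 2 * j - 1 + 1 = 2 * j by omega] at this
    refine this.mono ?_
    rintro D (rfl | hD)
    exacts [h.y_mem b hb, ⟨hD.1, hD.2.1⟩]
  · obtain ⟨c, -, hcz, hp⟩ := h.path b hb j (by omega) (by omega)
    have := (hp.concat hcz (by simp)).concat (h.z_adj_y b hb)
      (by simpa using (h.z_adj_y b hb).ne')
    rw [show 2 * j - 1 + 1 + 1 = 2 * j + 1 by omega] at this
    refine this.mono ?_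
    rintro D (rfl | rfl | hD)
    exacts [h.y_mem b hb, h.z_mem b hb, ⟨hD.1, hD.2.1⟩]

/-- Over a path with an odd number of vertices, all vertex numbers from `2` on occur. -/
theorem hasPathOn (h : LadderFibration G H X P π x y z r) :
    ∀ (b : β) (l : List β), (b :: l).Nodup → (b :: l).IsChain H.Adj → (∀ t ∈ b :: l, t ∈ P) →
      Even l.length → ∀ n, 2 ≤ n → n ≤ ((b :: l).map fun t => 2 * r t + 1).sum →
      G.HasPathOn (x b) (y b) {D | D ∈ X ∧ π D ∈ b :: l} n
  | b, [], _, _, hP, _, n, hn, hn' => by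
    refine (h.hasPathOn_fibre (hP b (by simp)) hn (by simpa using hn')).mono ?_
    rintro D ⟨hD, rfl⟩
    exact ⟨hD, by simp⟩
  | b, [b'], _, _, _, hl, _, _, _ => by simp at hl
  -- Two base vertices are consumed at a time, hence the parity condition: a path leaving `b` along
  -- the `z` rail returns to the `x` rail over `b'`.
  | b, b' :: b'' :: l, hnd, hch, hP, hl, n, hn, hn' => by
    have hb : b ∈ P := hP b (by simp)
    have hb' : b' ∈ P := hP b' (by simp)
    have hb'' : b'' ∈ P := hP b'' (by simp)
    rw [List.isChain_cons_cons, List.isChain_cons_cons] at hch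
    obtain ⟨hbb', hb'b'', hch⟩ := hch
    rw [List.nodup_cons, List.nodup_cons, List.mem_cons, not_or] at hnd
    obtain ⟨⟨hne, hbl⟩, hb'l, hnd⟩ := hnd
    have ih := h.hasPathOn b'' l hnd hch
      (fun t ht => hP t (List.mem_cons_of_mem _ (List.mem_cons_of_mem _ ht)))
      (by simpa [Nat.even_add_one] using hl)
    replace hn' : n ≤ (2 * r b + 1) + ((2 * r b' + 1) +
      ((b'' :: l).map fun t => 2 * r t + 1).sum) := by
      simpa only [List.map_cons, List.sum_cons] using hn'
    have hN : 3 ≤ ((b'' :: l).map fun t => 2 * r t + 1).sum := by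
      have := h.one_le b'' hb''
      simp only [List.map_cons, List.sum_cons]
      omega
    have h1 := h.one_le b hb
    have h1' := h.one_le b' hb'
    generalize ((b'' :: l).map fun t => 2 * r t + 1).sum = N at *
    have hx := h.x_mem b hb
    have hy := h.y_mem b hb
    have hz := h.z_mem b hb
    have hx' := h.x_mem b' hb'
    have hy' := h.y_mem b' hb'
    have hz' := h.z_mem b' hb'
    have hxy := (h.x_adj_y b hb).ne
    have hxy' := (h.x_adj_y b' hb').ne
    have hzy := (h.z_adj_y b hb).ne
    have hzy' := (h.z_adj_y b' hb').ne
    obtain hn5 | hn6 := le_or_gt n 3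
    · refine (h.hasPathOn_fibre hb hn (by omega)).mono ?_
      rintro D ⟨hD, rfl⟩
      exact ⟨hD, by simp⟩
    obtain hn5 | hn6 := le_or_gt n 5
    -- Only the fibre over `b'` is traversed, between `x b` and `y b`.
    · obtain ⟨k, rfl⟩ : ∃ k, n = k + 1 + 1 := ⟨n - 2, by omega⟩
      have hp := h.hasPathOn_fibre hb' (n := k) (by omega) (by omega)
      refine ((hp.concat (h.y_adj_y b hb b' hb' hbb').symm ?_).cons
        (h.x_adj_x b hb b' hb' hbb') ?_).mono ?_
      · simp only [Set.mem_ofPred_eq, hy.2, not_and]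
        exact fun _ => hne
      · simp only [Set.mem_insert_iff, Set.mem_ofPred_eq, hx.2, hxy, false_or, not_and]
        exact fun _ => hne
      · rintro D (rfl | rfl | ⟨hD, rfl⟩)
        · simp [hx]
        · simp [hy]
        · simp [hD]
    obtain hn5 | hn6 := le_or_gt n (N + 4)
    -- The `x` rail leads to `b''`, the `y` rail back; the rest lies beyond.
    · obtain ⟨k, rfl⟩ : ∃ k, n = k + 1 + 1 + 1 + 1 := ⟨n - 4, by omega⟩
      have hp := ih k (by omega) (by omega)
      refine ((((hp.concat (h.y_adj_y b' hb' b'' hb'' hb'b'').symm ?_).cons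
        (h.x_adj_x b' hb' b'' hb'' hb'b'') ?_).concat (h.y_adj_y b hb b' hb' hbb').symm ?_).cons
        (h.x_adj_x b hb b' hb' hbb') ?_).mono ?_
      · grind
      · grind
      · grind
      · grind
      · rintro D (rfl | rfl | rfl | rfl | ⟨hD, hD'⟩)
        · simp [hx]
        · simp [hy]
        · simp [hx']
        · simp [hy']
        · exact ⟨hD, by grind⟩
    -- Long paths run from `x b` through the fibre to `z b`, cross to `z b'`, run backwards through
    -- that fibre to `x b'`, use `k` vertices from `b''` on, and return through `y b'` and `y b`.
    -- Here `k` is `N` or `N - 1` to fix the parity, and `j + j' = t`.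
    obtain ⟨k, j, j', hk, hkN, hj, hjr, hj', hjr', rfl⟩ : ∃ k j j', 2 ≤ k ∧ k ≤ N ∧ 1 ≤ j ∧ j ≤ r b ∧
        1 ≤ j' ∧ j' ≤ r b' ∧ n = 2 * j - 1 + 1 + (2 * j' - 1 + 1) + k + 1 + 1 := by
      obtain ⟨t, e, he, ht⟩ : ∃ t e, e ≤ 1 ∧ n + e = N + 2 * t + 2 :=
        ⟨(n - N - 1) / 2, (n - N) % 2, by omega, by omega⟩
      obtain hrt | hrt := le_or_gt t (r b + 1)
      · exact ⟨N - e, t - 1, 1, by omega⟩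
      · exact ⟨N - e, r b, t - r b, by omega⟩
    obtain ⟨c, -, hcz, hp⟩ := h.path b hb j hj hjr
    obtain ⟨c', -, hcz', hp'⟩ := h.path b' hb' j' hj' hjr'
    refine ((((((hp.concat hcz ?_).append (h.z_adj_z b hb b' hb' hbb') (hp'.concat hcz' ?_).symm
      ?_).append (h.x_adj_x b' hb' b'' hb'' hb'b'') (ih k hk hkN) ?_).concat
      (h.y_adj_y b' hb' b'' hb'' hb'b'').symm ?_).concat
      (h.y_adj_y b hb b' hb' hbb').symm ?_)).mono ?_
    · simp
    · simp
    · rintro s (rfl | ⟨-, hs, -⟩) (hs' | ⟨-, hs', -⟩)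
      · exact hne (by rw [← hz.2, hs', hz'.2])
      · exact hne (by rw [← hz.2, hs'])
      · exact hne (by rw [← hs, hs', hz'.2])
      · exact hne (by rw [← hs, hs'])
    · rintro s ((rfl | ⟨-, hs, -⟩) | (rfl | ⟨-, hs, -⟩)) ⟨-, hs'⟩
      · exact hbl (hz.2 ▸ hs')
      · exact hbl (hs ▸ hs')
      · exact hb'l (hz'.2 ▸ hs')
      · exact hb'l (hs ▸ hs')
    · rintro (((hs | ⟨-, hs, -⟩) | (hs | ⟨-, -, hs, -⟩)) | ⟨-, hs⟩)
      · exact hne (by rw [← hz.2, ← hs, hy'.2])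
      · exact hne (by rw [← hs, hy'.2])
      · exact hzy' hs.symm
      · exact hs rfl
      · exact hb'l (hy'.2 ▸ hs)
    · rintro (hs | ((hs | ⟨-, -, hs, -⟩) | (hs | ⟨-, hs, -⟩)) | ⟨-, hs⟩)
      · exact hne (by rw [← hy.2, hs, hy'.2])
      · exact hzy hs.symm
      · exact hs rfl
      · exact hne (by rw [← hy.2, hs, hz'.2])
      · exact hne (by rw [← hs, hy.2])
      · exact hbl (hy.2 ▸ hs)
    · rintro D (rfl | rfl | ((rfl | hD) | (rfl | hD)) | ⟨hD, hD'⟩)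
      · simp [hy]
      · simp [hy']
      · simp [hz]
      · simp [hD.1, hD.2.1]
      · simp [hz']
      · simp [hD.1, hD.2.1]
      · exact ⟨hD, by grind⟩

end LadderFibration

end SimpleGraph

/-! ### Token moves on arbitrary vertex sets, and Gray codes -/

namespace SimpleGraph

variable {V : Type*}

/-- The graph on all sets of vertices of `F` given by token addition, removal and sliding. -/
def tokenGraph (F : SimpleGraph V) : SimpleGraph (Set V) where
  Adj X Y := TokenAddRemove X Y ∨ TokenSlide F X Y
  symm := ⟨fun _ _ h => h.imp TokenAddRemove.symm TokenSlide.symm⟩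
  loopless := ⟨fun _ h => h.elim (fun h => h.ne rfl) (fun h => h.ne rfl)⟩

/-- The vertices of `W` neither in `S` nor adjacent to a vertex of `S`. -/
def undominated (F : SimpleGraph V) (W S : Set V) : Set V :=
  {w | w ∈ W ∧ w ∉ S ∧ ∀ s ∈ S, ¬F.Adj w s}

/-- The dominating sets of the subgraph of `F` induced by `W`. -/
def dominatingSetsOn (F : SimpleGraph V) (W : Set V) : Set (Set V) :=
  {S | S ⊆ W ∧ F.undominated W S = ∅}

theorem mem_dominatingSetsOn_univ {F : SimpleGraph V} {S : Set V} :
    S ∈ F.dominatingSetsOn Set.univ ↔ F.IsDominatingSet S := by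
  simp only [dominatingSetsOn, undominated, IsDominatingSet, Set.mem_ofPred_eq, Set.subset_univ,
    true_and, Set.mem_univ, Set.eq_empty_iff_forall_notMem]
  grind

theorem TokenAddRemove.union {S T K : Set V} (h : TokenAddRemove S T) (hS : Disjoint S K)
    (hT : Disjoint T K) : TokenAddRemove (S ∪ K) (T ∪ K) := by
  rw [Set.disjoint_left] at hS hT
  rcases h with ⟨v, hv, rfl⟩ | ⟨v, hv, rfl⟩
  · exact Or.inl ⟨v, by grind, by grind⟩
  · exact Or.inr ⟨v, by grind, by grind⟩

theorem tokenGraph_adj_union {F : SimpleGraph V} {S T K : Set V} (h : F.tokenGraph.Adj S T)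
    (hS : Disjoint S K) (hT : Disjoint T K) : F.tokenGraph.Adj (S ∪ K) (T ∪ K) := by
  rcases h with h | ⟨a, ha, c, hc, hac, rfl⟩
  · exact Or.inl (h.union hS hT)
  · rw [Set.disjoint_left] at hS hT
    exact Or.inr ⟨a, by grind, c, by grind, hac, by grind⟩

/-- A Gray code for the sets between `b \ C` and `b`, starting at `b`. -/
theorem exists_grayCode (b : Set V) {C : Set V} (hC : C.Finite) :
    C ⊆ b → ∃ l : List (Set V), (b :: l).Nodup ∧ (b :: l).IsChain TokenAddRemove ∧
      ∀ S, S ∈ b :: l ↔ b \ C ⊆ S ∧ S ⊆ b := by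
  induction C, hC using Set.Finite.induction_on with
  | empty =>
    refine fun _ => ⟨[], by simp, by simp, fun S => ?_⟩
    simpa using ⟨fun h => ⟨h.ge, h.le⟩, fun h => h.2.antisymm h.1⟩
  | @insert a C haC _ ih =>
    intro hb
    rw [Set.insert_subset_iff] at hb
    obtain ⟨l, hnd, hch, hl⟩ := ih hb.2
    have ha : ∀ S ∈ b :: l, a ∈ S := fun S hS => ((hl S).1 hS).1 ⟨hb.1, haC⟩
    -- Reflected Gray code: the code with `a` present, then its reversal with `a` removed.
    refine ⟨l ++ ((b :: l).map (· \ {a})).reverse, ?_, ?_, fun S => ?_⟩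
    · rw [← List.cons_append, List.nodup_append]
      refine ⟨hnd, List.nodup_reverse.2 (hnd.map_on fun S hS T hT hST => ?_), ?_⟩
      · rw [← Set.insert_sdiff_self_of_mem (ha S hS), hST, Set.insert_sdiff_self_of_mem (ha T hT)]
      · rintro S hS T hT rfl
        obtain ⟨T, -, rfl⟩ := List.mem_map.1 (List.mem_reverse.1 hT)
        exact (ha _ hS).2 rfl
    · rw [← List.cons_append, List.isChain_append]
      refine ⟨hch, ?_, ?_⟩
      · rw [List.isChain_reverse, List.isChain_map]
        refine hch.imp_of_mem_imp fun S T hS hT h => TokenAddRemove.symm ?_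
        have hS := ha S hS
        have hT := ha T hT
        rcases h with ⟨c, hc, rfl⟩ | ⟨c, hc, rfl⟩
        · exact Or.inl ⟨c, by grind, by grind⟩
        · exact Or.inr ⟨c, by grind, by grind⟩
      · rw [List.head?_reverse, List.getLast?_map]
        intro S hS T hT
        rw [Option.mem_def] at hS
        rw [hS] at hT
        obtain rfl : S \ {a} = T := by simpa using hT
        exact Or.inr ⟨a, ha S (List.mem_of_getLast? hS), rfl⟩
    · rw [← List.cons_append, List.mem_append, hl, List.mem_reverse, List.mem_map]
      simp only [hl]
      constructor
      · rintro (h | ⟨T, h, rfl⟩)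
        · grind
        · grind
      · rintro ⟨h, h'⟩
        by_cases haS : a ∈ S
        · exact Or.inl (by grind)
        · exact Or.inr ⟨insert a S, by grind, by grind⟩

end SimpleGraph

/-! ### Fibres of the leaf deletion -/

namespace SimpleGraph

variable {V : Type*} {F : SimpleGraph V} {W S b D : Set V} {u v : V}

theorem IsAcyclic.not_adj_of_adj_adj (hF : F.IsAcyclic) {a c d : V} (hac : F.Adj a c)
    (hcd : F.Adj c d) : ¬F.Adj a d := by
  intro had
  have h := hF.eq_snd_of_adj_start (p := .cons hac (.cons hcd .nil)) (w := d)
    (by simp [hac.ne, hcd.ne, had.ne]) had (by simp)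
  exact hcd.ne' (by simpa using h)

theorem IsAcyclic.eq_of_common_adj (hF : F.IsAcyclic) {p q c d : V} (hcd : c ≠ d)
    (hpc : F.Adj p c) (hpd : F.Adj p d) (hqc : F.Adj q c) (hqd : F.Adj q d) : p = q := by
  by_contra hpq
  have h := hF.eq_snd_of_adj_start (p := .cons hpc (.cons hqc.symm (.cons hqd .nil))) (w := d)
    (by simp [hpc.ne, hqc.ne', hqd.ne, hpd.ne, hpq, hcd]) hpd (by simp)
  exact hcd (by simpa using h.symm)

/-- The neighbours `w` of `u` in `b` whose removal from `b` leaves exactly `w` undominated. -/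
def detachable (F : SimpleGraph V) (W : Set V) (u : V) (b : Set V) : Set V :=
  {w | w ∈ b ∧ F.Adj u w ∧ F.undominated W (b \ {w}) = {w}}

/-- Losing one detachable vertex leaves no vertex outside `b` undominated, so such a vertex could
only be lost by having two detachable neighbours. Both are adjacent to `u`, and a forest has no
4-cycle. -/
theorem undominated_eq_sdiff (hF : F.IsAcyclic) (hu : u ∉ W) (hb : b ∈ F.dominatingSetsOn W)
    (hS : b \ F.detachable W u b ⊆ S) (hSb : S ⊆ b) : F.undominated W S = b \ S := by
  ext q
  constructor
  · rintro ⟨hqW, hqS, hq⟩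
    refine ⟨by_contra fun hqb => ?_, hqS⟩
    have hdet : ∀ s ∈ b, F.Adj q s → s ∈ F.detachable W u b := fun s hs hqs =>
      by_contra fun h => hq s (hS ⟨hs, h⟩) hqs
    obtain ⟨s, hs, hqs⟩ : ∃ s ∈ b, F.Adj q s := by
      by_contra! h
      exact (hb.2 ▸ (⟨hqW, hqb, h⟩ : q ∈ F.undominated W b) : q ∈ (∅ : Set V))
    obtain ⟨-, hus, hs'⟩ := hdet s hs hqs
    obtain ⟨t, ht, hqt⟩ : ∃ t ∈ b \ {s}, F.Adj q t := by
      by_contra! h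
      have : q ∈ F.undominated W (b \ {s}) := ⟨hqW, fun h => hqb h.1, h⟩
      rw [hs'] at this
      exact hqb (this ▸ hs)
    exact hu (hF.eq_of_common_adj ht.2 hqt hqs (hdet t ht.1 hqt).2.1 hus ▸ hqW)
  · rintro ⟨hqb, hqS⟩
    have hq : q ∈ F.detachable W u b := by_contra fun h => hqS (hS ⟨hqb, h⟩)
    have : q ∈ F.undominated W (b \ {q}) := by
      rw [hq.2.2]
      rfl
    refine ⟨this.1, hqS, fun s hs => this.2.2 s ⟨hSb hs, ?_⟩⟩
    rintro rfl
    exact hqS hs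

theorem union_undominated_mem (hS : S ⊆ W) : S ∪ F.undominated W S ∈ F.dominatingSetsOn W := by
  refine ⟨Set.union_subset hS fun w hw => hw.1, Set.eq_empty_of_forall_notMem ?_⟩
  rintro w ⟨hwW, hw, hw'⟩
  exact hw (Or.inr ⟨hwW, fun h => hw (Or.inl h), fun s hs => hw' s (Or.inl hs)⟩)

/-- The added vertices are neighbours of `u`, hence pairwise non-adjacent in a forest, so each
dominates itself alone among them and is detachable. -/
theorem sdiff_detachable_subset (hF : F.IsAcyclic)
    (hu : F.undominated W S ⊆ F.neighborSet u) :
    (S ∪ F.undominated W S) \ F.detachable W u (S ∪ F.undominated W S) ⊆ S := by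
  rintro w ⟨hw | hw, hw'⟩
  · exact hw
  refine absurd ⟨Or.inr hw, hu hw, ?_⟩ hw'
  ext q
  rw [Set.mem_singleton_iff]
  constructor
  · rintro ⟨hqW, hq, hq'⟩
    by_contra hqw
    have hS : ∀ s ∈ S, s ∈ (S ∪ F.undominated W S) \ {w} := by
      rintro s hs
      refine ⟨Or.inl hs, ?_⟩
      rintro rfl
      exact hw.2.1 hs
    exact hq ⟨Or.inr ⟨hqW, fun h => hq (hS q h), fun s hs => hq' s (hS s hs)⟩, hqw⟩
  · rintro rfl
    refine ⟨hw.1, fun h => h.2 rfl, ?_⟩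
    rintro s ⟨hs | hs, -⟩
    · exact hw.2.2 s hs
    · exact fun h => hF.not_adj_of_adj_adj (hu hw) h (hu hs)

theorem union_undominated_eq_iff (hF : F.IsAcyclic) (hu : u ∉ W)
    (hb : b ∈ F.dominatingSetsOn W) :
    (S ⊆ W ∧ F.undominated W S ⊆ F.neighborSet u ∧ S ∪ F.undominated W S = b) ↔
      b \ F.detachable W u b ⊆ S ∧ S ⊆ b := by
  constructor
  · rintro ⟨-, hSu, rfl⟩
    exact ⟨sdiff_detachable_subset hF hSu, Set.subset_union_left⟩
  · rintro ⟨hS, hSb⟩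
    rw [undominated_eq_sdiff hF hu hb hS hSb]
    refine ⟨hSb.trans hb.1, fun w hw => ?_, Set.union_sdiff_cancel hSb⟩
    by_contra h
    exact hw.2 (hS ⟨hw.1, fun h' => h h'.2.1⟩)

/-- `v` is a leaf of the subgraph of `F` induced by `W`, with neighbour `u`. -/
structure IsLeafOn (F : SimpleGraph V) (W : Set V) (u v : V) : Prop where
  left_mem : u ∈ W
  right_mem : v ∈ W
  adj : F.Adj u v
  eq_of_adj : ∀ w ∈ W, F.Adj v w → w = u

/-- Forgets `u` and `v` and adds the vertices that are then undominated. -/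
def baseSet (F : SimpleGraph V) (W : Set V) (u v : V) (D : Set V) : Set V :=
  (D \ {u, v}) ∪ F.undominated (W \ {u, v}) (D \ {u, v})

theorem baseSet_union {K : Set V} (hS : S ⊆ W \ {u, v}) (hK : K ⊆ {u, v}) :
    F.baseSet W u v (S ∪ K) = S ∪ F.undominated (W \ {u, v}) S := by
  have : (S ∪ K) \ {u, v} = S := by grind
  rw [baseSet, this]

namespace IsLeafOn

/-- The token on `u` covers `u`, `v` and the neighbours of `u`; a token on `v` covers nothing
further. -/
theorem left_union_mem_iff (h : F.IsLeafOn W u v) {K : Set V} (hS : S ⊆ W \ {u, v})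
    (hK : K ⊆ {u, v}) (hu : u ∈ K) : S ∪ K ∈ F.dominatingSetsOn W ↔
      F.undominated (W \ {u, v}) S ⊆ F.neighborSet u := by
  constructor
  · rintro ⟨-, hU⟩ w ⟨hwW, hw, hw'⟩
    by_contra hwu
    refine (hU ▸ (?_ : w ∈ F.undominated W (S ∪ K)) : w ∈ (∅ : Set V))
    refine ⟨hwW.1, by grind, ?_⟩
    rintro s (hs | hs)
    · exact hw' s hs
    · rcases hK hs with rfl | rfl
      · exact fun h => hwu h.symm
      · exact fun hws => hwW.2 (Or.inl (h.eq_of_adj w hwW.1 hws.symm))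
  · intro hU
    have h1 := h.left_mem
    have h2 := h.right_mem
    refine ⟨by grind, Set.eq_empty_of_forall_notMem ?_⟩
    rintro w ⟨hwW, hw, hw'⟩
    have hwu : w ≠ u := by grind
    have hwv : w ≠ v := by
      rintro rfl
      exact hw' u (Or.inr hu) h.adj.symm
    have : w ∈ F.undominated (W \ {u, v}) S :=
      ⟨⟨hwW, by grind⟩, fun h => hw (Or.inl h), fun s hs => hw' s (Or.inl hs)⟩
    exact hw' u (Or.inr hu) (hU this).symm

theorem right_union_mem_iff (h : F.IsLeafOn W u v) (hS : S ⊆ W \ {u, v}) :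
    S ∪ {v} ∈ F.dominatingSetsOn W ↔ F.undominated (W \ {u, v}) S = ∅ := by
  constructor
  · rintro ⟨-, hU⟩
    refine Set.eq_empty_of_forall_notMem ?_
    rintro w ⟨hwW, hw, hw'⟩
    refine (hU ▸ (?_ : w ∈ F.undominated W (S ∪ {v})) : w ∈ (∅ : Set V))
    refine ⟨hwW.1, by grind, ?_⟩
    rintro s (hs | rfl)
    · exact hw' s hs
    · exact fun hws => hwW.2 (Or.inl (h.eq_of_adj w hwW.1 hws.symm))
  · intro hU
    have h2 := h.right_mem
    refine ⟨by grind, Set.eq_empty_of_forall_notMem ?_⟩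
    rintro w ⟨hwW, hw, hw'⟩
    have hwv : w ≠ v := by grind
    have hwu : w ≠ u := by
      rintro rfl
      exact hw' v (Or.inr rfl) h.adj
    refine (hU ▸ (?_ : w ∈ F.undominated (W \ {u, v}) S) : w ∈ (∅ : Set V))
    exact ⟨⟨hwW, by grind⟩, fun h => hw (Or.inl h), fun s hs => hw' s (Or.inl hs)⟩

theorem left_mem_or_right_mem (h : F.IsLeafOn W u v) (hD : D ∈ F.dominatingSetsOn W) :
    u ∈ D ∨ v ∈ D := by
  by_contra! hn
  refine (hD.2 ▸ (?_ : v ∈ F.undominated W D) : v ∈ (∅ : Set V))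
  refine ⟨h.right_mem, hn.2, fun s hs hvs => hn.1 ?_⟩
  rwa [← h.eq_of_adj s (hD.1 hs) hvs]

theorem baseSet_mem (hD : D ∈ F.dominatingSetsOn W) :
    F.baseSet W u v D ∈ F.dominatingSetsOn (W \ {u, v}) :=
  union_undominated_mem fun _ hw => ⟨hD.1 hw.1, hw.2⟩

theorem fibre_eq (h : F.IsLeafOn W u v) (hF : F.IsAcyclic)
    (hb : b ∈ F.dominatingSetsOn (W \ {u, v})) :
    {D | D ∈ F.dominatingSetsOn W ∧ F.baseSet W u v D = b} =
      insert (b ∪ {v}) ((· ∪ {u}) '' {S | b \ F.detachable (W \ {u, v}) u b ⊆ S ∧ S ⊆ b} ∪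
        (· ∪ {u, v}) '' {S | b \ F.detachable (W \ {u, v}) u b ⊆ S ∧ S ⊆ b}) := by
  have hu : u ∉ W \ {u, v} := fun h => h.2 (Or.inl rfl)
  have huv := h.adj.ne
  ext D
  constructor
  · rintro ⟨hD, hDb⟩
    have hS : D \ {u, v} ⊆ W \ {u, v} := fun _ hw => ⟨hD.1 hw.1, hw.2⟩
    by_cases huD : u ∈ D
    · obtain ⟨K, hK, huK, hDK, hK'⟩ : ∃ K ⊆ {u, v}, u ∈ K ∧ D = D \ {u, v} ∪ K ∧
          (K = {u} ∨ K = {u, v}) := by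
        by_cases hvD : v ∈ D
        · exact ⟨{u, v}, by grind, by grind, by grind, by grind⟩
        · exact ⟨{u}, by grind, by grind, by grind, by grind⟩
      have hU := (h.left_union_mem_iff hS hK huK).1 (hDK ▸ hD)
      have hcell := (union_undominated_eq_iff hF hu hb).1 ⟨hS, hU, hDb⟩
      rcases hK' with rfl | rfl
      · exact Or.inr (Or.inl ⟨_, hcell, hDK.symm⟩)
      · exact Or.inr (Or.inr ⟨_, hcell, hDK.symm⟩)
    · have hvD := (h.left_mem_or_right_mem hD).resolve_left huD
      have hDK : D = D \ {u, v} ∪ {v} := by grind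
      have hU := (h.right_union_mem_iff hS).1 (hDK ▸ hD)
      rw [baseSet, hU, Set.union_empty] at hDb
      rw [hDb] at hDK
      exact Or.inl hDK
  · rintro (rfl | ⟨S, hS, rfl⟩ | ⟨S, hS, rfl⟩)
    · refine ⟨(h.right_union_mem_iff hb.1).2 hb.2, ?_⟩
      rw [baseSet_union hb.1 (by grind), hb.2, Set.union_empty]
    · obtain ⟨hSW, hU, rfl⟩ := (union_undominated_eq_iff hF hu hb).2 hS
      exact ⟨(h.left_union_mem_iff hSW (by grind) (by grind)).2 hU, baseSet_union hSW (by grind)⟩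
    · obtain ⟨hSW, hU, rfl⟩ := (union_undominated_eq_iff hF hu hb).2 hS
      exact ⟨(h.left_union_mem_iff hSW (by grind) (by grind)).2 hU, baseSet_union hSW (by grind)⟩

/-- Membership of `u` and `v` separates the three families; `b ∪ {v}` accounts for the odd summand.
-/
theorem ncard_fibre [Finite V] (h : F.IsLeafOn W u v) (hF : F.IsAcyclic)
    (hb : b ∈ F.dominatingSetsOn (W \ {u, v})) :
    {D | D ∈ F.dominatingSetsOn W ∧ F.baseSet W u v D = b}.ncard =
      2 * {S | b \ F.detachable (W \ {u, v}) u b ⊆ S ∧ S ⊆ b}.ncard + 1 := by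
  have huv := h.adj.ne
  have hnot : ∀ S ⊆ b, u ∉ S ∧ v ∉ S := fun S hS =>
    ⟨fun hw => (hb.1 (hS hw)).2 (Or.inl rfl), fun hw => (hb.1 (hS hw)).2 (Or.inr rfl)⟩
  have hinj : ∀ K ⊆ ({u, v} : Set V),
      {S | b \ F.detachable (W \ {u, v}) u b ⊆ S ∧ S ⊆ b}.InjOn (· ∪ K) := by
    intro K hK S hS T hT hST
    have hS := hnot S hS.2
    have hT := hnot T hT.2
    ext w
    have := Set.ext_iff.1 hST w
    grind
  rw [h.fibre_eq hF hb, Set.ncard_insert_of_notMem, Set.ncard_union_eq,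
    (hinj _ (by grind)).ncard_image, (hinj _ (by grind)).ncard_image,
    two_mul]
  · rw [Set.disjoint_left]
    rintro _ ⟨S, hS, rfl⟩ ⟨T, hT, hST⟩
    have := (hnot S hS.2).2
    have : v ∈ S ∪ {u} := by
      change T ∪ {u, v} = S ∪ {u} at hST
      rw [← hST]
      grind
    grind
  · have := hnot b subset_rfl
    rintro (⟨S, hS, hST⟩ | ⟨S, hS, hST⟩)
    all_goals
      have : u ∈ b ∪ {v} := by
        rw [← hST]
        exact Or.inr (by simp)
      grind

end IsLeafOn

end SimpleGraph

/-! ### Dominating sets of a forest as a ladder fibration -/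

namespace SimpleGraph

variable {V : Type*} {F : SimpleGraph V} {W S b D : Set V} {u v : V}

/-- Sliding the token from `w` to `u` links `b ∪ {v}` to the second rung of the prism. -/
theorem TokenSlide.sdiff_union (huv : u ≠ v) (hbW : b ⊆ W \ {u, v}) {w : V} (hw : w ∈ b)
    (huw : F.Adj u w) : TokenSlide F (b ∪ {v}) (b \ {w} ∪ {u, v}) := by
  have hwW := (hbW hw).2
  refine ⟨w, Or.inl hw, u, ⟨Or.inr (Or.inl rfl), ?_⟩, huw.symm, ?_⟩
  · rintro (h | h)
    exacts [(hbW h).2 (Or.inl rfl), huv h]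
  · ext t
    by_cases htw : t = w
    · subst htw
      simpa using hwW
    · simp [htw]

namespace IsLeafOn

theorem ladderFibration [Finite V] (h : F.IsLeafOn W u v) (hF : F.IsAcyclic) :
    LadderFibration F.tokenGraph F.tokenGraph (F.dominatingSetsOn W)
      (F.dominatingSetsOn (W \ {u, v})) (F.baseSet W u v) (· ∪ {u}) (· ∪ {u, v}) (· ∪ {v})
      fun b => {S | b \ F.detachable (W \ {u, v}) u b ⊆ S ∧ S ⊆ b}.ncard := by
  have huv := h.adj.ne
  have hfib := fun b hb => h.fibre_eq hF (b := b) hb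
  have hself : ∀ b, b ∈ {S | b \ F.detachable (W \ {u, v}) u b ⊆ S ∧ S ⊆ b} := fun b =>
    ⟨Set.sdiff_subset, subset_rfl⟩
  have hdisj : ∀ S ⊆ W \ {u, v}, ∀ K ⊆ ({u, v} : Set V), Disjoint S K := fun S hS K hK =>
    Set.disjoint_left.2 fun w hw hwK => (hS hw).2 (hK hwK)
  have hadj : ∀ K ⊆ ({u, v} : Set V), ∀ S ⊆ W \ {u, v}, ∀ T ⊆ W \ {u, v},
      F.tokenGraph.Adj S T → F.tokenGraph.Adj (S ∪ K) (T ∪ K) := fun K hK S hS T hT hST =>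
    tokenGraph_adj_union hST (hdisj S hS K hK) (hdisj T hT K hK)
  have hxy : ∀ b ⊆ W \ {u, v}, F.tokenGraph.Adj (b ∪ {u}) (b ∪ {u, v}) := fun b hb =>
    Or.inl (Or.inl ⟨v, by grind, by grind⟩)
  have hzy : ∀ b ⊆ W \ {u, v}, F.tokenGraph.Adj (b ∪ {v}) (b ∪ {u, v}) := fun b hb =>
    Or.inl (Or.inl ⟨u, by grind, by grind⟩)
  have hxz : ∀ b ⊆ W \ {u, v}, F.tokenGraph.Adj (b ∪ {u}) (b ∪ {v}) := fun b hb =>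
    Or.inr ⟨u, by grind, v, by grind, h.adj, by grind⟩
  have hinj : ∀ K ⊆ ({u, v} : Set V), (𝒫 (W \ {u, v})).InjOn (· ∪ K) := by
    intro K hK S hS T hT hST
    rw [← Set.union_sdiff_cancel_right (hdisj S hS K hK).le_bot,
      ← Set.union_sdiff_cancel_right (hdisj T hT K hK).le_bot]
    exact congrArg (· \ K) hST
  refine
    { x_mem := fun b hb => (hfib b hb).ge (Or.inr (Or.inl ⟨b, hself b, rfl⟩))
      y_mem := fun b hb => (hfib b hb).ge (Or.inr (Or.inr ⟨b, hself b, rfl⟩))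
      z_mem := fun b hb => (hfib b hb).ge (Or.inl rfl)
      x_adj_y := fun b hb => hxy b hb.1
      x_adj_z := fun b hb => hxz b hb.1
      z_adj_y := fun b hb => hzy b hb.1
      x_adj_x := fun b hb b' hb' => hadj _ (by grind) _ hb.1 _ hb'.1
      y_adj_y := fun b hb b' hb' => hadj _ (by grind) _ hb.1 _ hb'.1
      z_adj_z := fun b hb b' hb' => hadj _ (by grind) _ hb.1 _ hb'.1
      one_le := fun b hb => (Set.ncard_pos (Set.toFinite _)).2 ⟨b, hself b⟩
      path := fun b hb j hj hjr => ?_ }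
  obtain ⟨l, hnd, hch, hl⟩ := exists_grayCode b
    (Set.toFinite (F.detachable (W \ {u, v}) u b)) fun w hw => hw.1
  have hlen : {S | b \ F.detachable (W \ {u, v}) u b ⊆ S ∧ S ⊆ b}.ncard = l.length + 1 := by
    classical
    rw [← List.length_cons, ← List.toFinset_card_of_nodup hnd, ← Set.ncard_coe_finset]
    congr 1
    ext S
    simp only [List.coe_toFinset]
    exact (hl S).symm
  rw [hlen] at hjr
  have hlW : ∀ S ∈ b :: l, S ∈ 𝒫 (W \ {u, v}) := fun S hS => ((hl S).1 hS).2.trans hb.1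
  obtain ⟨c, hcy, hc, hp⟩ := exists_hasPathOn_prism (G := F.tokenGraph) (P := 𝒫 (W \ {u, v}))
    (x := (· ∪ {u})) (y := (· ∪ {u, v})) (fun S hS T hT hST => by
      have : v ∈ S ∪ {u} := hST.ge (Or.inr (Or.inr rfl))
      exact this.elim (fun h => (hS h).2 (Or.inr rfl)) fun h => huv h.symm)
    (hinj _ (by grind)) (hinj _ (by grind)) (fun S hS => hxy S hS) (j - 1) b l hnd hlW
    (hch.imp_of_mem_imp fun S T hS hT hST =>
      ⟨hadj _ (by grind) _ (hlW S hS) _ (hlW T hT) (Or.inl hST),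
        hadj _ (by grind) _ (hlW S hS) _ (hlW T hT) (Or.inl hST)⟩) (by omega)
  rw [show 2 * (j - 1) + 1 = 2 * j - 1 by omega] at hp
  refine ⟨c, hcy, ?_, hp.mono ?_⟩
  -- The prism path ends at `b ∪ {u}` or on the second rung. The first Gray code step can only
  -- delete a detachable `w`, which is adjacent to `u`.
  · rcases hc with rfl | ⟨S, l', rfl, rfl⟩
    · exact hxz b hb.1
    have hS := (hl S).1 (by simp)
    rcases (List.isChain_cons_cons.1 hch).1 with ⟨w, hw, rfl⟩ | ⟨w, hw, rfl⟩
    · exact absurd (hS.2 (Or.inr rfl)) hw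
    · have hwu : F.Adj u w := by
        by_contra hwu
        exact (hS.1 ⟨hw, fun h' => hwu h'.2.1⟩).2 rfl
      have : F.tokenGraph.Adj (b ∪ {v}) (b \ {w} ∪ {u, v}) :=
        Or.inr (TokenSlide.sdiff_union huv hb.1 hw hwu)
      exact this.symm
  · rintro D ⟨S, hS, hD⟩
    have hSW := hlW S hS
    have huS : u ∈ D := by
      rcases hD with rfl | ⟨rfl, -⟩
      exacts [Or.inr rfl, Or.inr (Or.inl rfl)]
    have hmem : D ∈ {D | D ∈ F.dominatingSetsOn W ∧ F.baseSet W u v D = b} := by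
      rw [hfib b hb]
      rcases hD with rfl | ⟨rfl, -⟩
      exacts [Or.inr (Or.inl ⟨S, (hl S).1 hS, rfl⟩), Or.inr (Or.inr ⟨S, (hl S).1 hS, rfl⟩)]
    refine ⟨hmem.1, hmem.2, ?_, ?_⟩
    · rintro rfl
      rcases hD with hD | ⟨hD, hSb⟩
      · have : v ∈ S ∪ {u} := hD.le (Or.inr (Or.inr rfl))
        exact this.elim (fun h => (hSW h).2 (Or.inr rfl)) fun h => huv h.symm
      · exact hSb (hinj _ subset_rfl hb.1 hSW hD).symm
    · rintro rfl
      exact huS.elim (fun h => (hb.1 h).2 (Or.inl rfl)) huv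

theorem ncard_dominatingSetsOn [Finite V] (h : F.IsLeafOn W u v) (hF : F.IsAcyclic)
    {L : List (Set V)} (hnd : L.Nodup) (hL : ∀ S, S ∈ L ↔ S ∈ F.dominatingSetsOn (W \ {u, v})) :
    (F.dominatingSetsOn W).ncard =
      (L.map fun b => 2 * {S | b \ F.detachable (W \ {u, v}) u b ⊆ S ∧ S ⊆ b}.ncard + 1).sum := by
  classical
  rw [← List.sum_toFinset _ hnd, Set.ncard_eq_toFinset_card _ (Set.toFinite _),
    Finset.card_eq_sum_card_fiberwise (f := F.baseSet W u v) (t := L.toFinset)]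
  · refine Finset.sum_congr rfl fun b hb => ?_
    rw [← h.ncard_fibre hF ((hL b).1 (List.mem_toFinset.1 hb)), ← Set.ncard_coe_finset]
    congr 1
    ext D
    simp
  · intro D hD
    simp only [List.coe_toFinset, Set.mem_ofPred_eq, hL]
    exact baseSet_mem (by simpa using hD)

/-- If the dominating sets of the forest without the leaf `v` and its neighbour `u` lie on a path
with an odd number of vertices, then paths with adjacent ends through dominating sets of the forest
exist on every number of vertices from `2` on. -/
theorem exists_hasPathOn [Finite V] (h : F.IsLeafOn W u v) (hF : F.IsAcyclic)
    {L : List (Set V)} (hnd : L.Nodup) (hch : L.IsChain F.tokenGraph.Adj) (hodd : Odd L.length)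
    (hL : ∀ S, S ∈ L ↔ S ∈ F.dominatingSetsOn (W \ {u, v})) {n : ℕ} (hn : 2 ≤ n)
    (hn' : n ≤ (F.dominatingSetsOn W).ncard) :
    ∃ S T, F.tokenGraph.Adj S T ∧ F.tokenGraph.HasPathOn S T (F.dominatingSetsOn W) n := by
  rw [h.ncard_dominatingSetsOn hF hnd hL] at hn'
  have hlad := h.ladderFibration hF
  cases L with
  | nil => simp at hodd
  | cons b l =>
    refine ⟨_, _, hlad.x_adj_y b ((hL b).1 (by simp)), (hlad.hasPathOn b l hnd hch
      (fun S hS => (hL S).1 hS) ?_ n hn hn').mono fun D hD => hD.1⟩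
    rw [List.length_cons, Nat.odd_add_one, Nat.not_odd_iff_even] at hodd
    exact hodd

end IsLeafOn

/-! ### Induction over the forest -/

/-- The end of a longest path in the induced subgraph is a leaf: another neighbour would extend the
path or close a cycle. -/
theorem IsAcyclic.exists_isLeafOn [Finite V] (hF : F.IsAcyclic) {a c : V} (ha : a ∈ W)
    (hc : c ∈ W) (hac : F.Adj a c) : ∃ u v, F.IsLeafOn W u v := by
  have : Nonempty W := ⟨⟨a, ha⟩⟩
  obtain ⟨s, t, p, hp, hmax⟩ := Walk.exists_isPath_forall_isPath_length_le_length (F.induce W)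
  have hnil : ¬p.Nil := by
    intro h
    have := hmax _ _ (Walk.cons (show (F.induce W).Adj ⟨a, ha⟩ ⟨c, hc⟩ from hac) .nil)
      (by simpa using hac.ne)
    rw [Walk.length_eq_zero_iff.2 h] at this
    simp at this
  refine ⟨p.penultimate, t, p.penultimate.2, t.2, p.adj_penultimate hnil, fun w hw htw => ?_⟩
  have htw' : (F.induce W).Adj t ⟨w, hw⟩ := htw
  refine congrArg Subtype.val
    ((hF.induce W).eq_penultimate_of_adj_end hp htw' (by_contra fun hws => ?_))
  have := hmax _ _ (p.concat htw') (hp.concat hws htw')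
  simp at this

theorem undominated_eq_sdiff_of_forall_not_adj (h : ∀ a ∈ W, ∀ c ∈ W, ¬F.Adj a c) (hS : S ⊆ W) :
    F.undominated W S = W \ S := by
  ext w
  exact ⟨fun hw => ⟨hw.1, hw.2.1⟩, fun hw => ⟨hw.1, hw.2, fun s hs => h w hw.1 s (hS hs)⟩⟩

theorem mem_dominatingSetsOn_of_forall_not_adj (h : ∀ a ∈ W, ∀ c ∈ W, ¬F.Adj a c) :
    S ∈ F.dominatingSetsOn W ↔ S = W := by
  constructor
  · rintro ⟨hS, hU⟩
    rw [undominated_eq_sdiff_of_forall_not_adj h hS, Set.sdiff_eq_empty] at hU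
    exact hS.antisymm hU
  · rintro rfl
    exact ⟨subset_rfl, by rw [undominated_eq_sdiff_of_forall_not_adj h subset_rfl, sdiff_self]; rfl⟩

/-- The dominating sets of a finite forest form a Hamiltonian path with an odd number of
vertices. -/
theorem IsAcyclic.exists_hamiltonian_list [Finite V] (hF : F.IsAcyclic) (W : Set V) :
    ∃ L : List (Set V), L.Nodup ∧ L.IsChain F.tokenGraph.Adj ∧ Odd L.length ∧
      ∀ S, S ∈ L ↔ S ∈ F.dominatingSetsOn W := by
  induction hk : W.ncard using Nat.strong_induction_on generalizing W with
  | _ k ih =>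
  subst hk
  by_cases h : ∃ a ∈ W, ∃ c ∈ W, F.Adj a c
  · obtain ⟨a, ha, c, hc, hac⟩ := h
    obtain ⟨u, v, huv⟩ := hF.exists_isLeafOn ha hc hac
    obtain ⟨L, hnd, hch, hodd, hL⟩ := ih _ (Set.ncard_lt_ncard
      ⟨Set.sdiff_subset, fun h => (h huv.left_mem).2 (Or.inl rfl)⟩ (Set.toFinite W))
      (W \ {u, v}) rfl
    have hcard := huv.ncard_dominatingSetsOn hF hnd hL
    have hodd' : Odd (F.dominatingSetsOn W).ncard := by
      rw [hcard]
      have : ∀ l : List (Set V), ∀ r : Set V → ℕ,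
          Odd (l.map fun b => 2 * r b + 1).sum ↔ Odd l.length := by
        intro l r
        induction l with
        | nil => simp
        | cons b l ih =>
          rw [List.map_cons, List.sum_cons, List.length_cons, Nat.odd_add_one, ← ih]
          grind
      exact (this L _).2 hodd
    have h2 : 2 ≤ (F.dominatingSetsOn W).ncard := by
      rw [hcard]
      cases L with
      | nil => simp at hodd
      | cons b l =>
        have := (huv.ladderFibration hF).one_le b ((hL b).1 (by simp))
        simp only [List.map_cons, List.sum_cons]
        omega
    obtain ⟨S, T, -, p, hp, hlen, hpW⟩ :=
      huv.exists_hasPathOn hF hnd hch hodd hL h2 le_rfl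
    refine ⟨p.support, hp.support_nodup, p.isChain_adj_support, ?_, fun D => ⟨hpW D, fun hD => ?_⟩⟩
    · rwa [Walk.length_support, hlen]
    · classical
      have hsub : (p.support.toFinset : Set (Set V)) ⊆ F.dominatingSetsOn W := fun D hD =>
        hpW D (by simpa using hD)
      have := Set.eq_of_subset_of_ncard_le hsub (by
        rw [Set.ncard_coe_finset, List.toFinset_card_of_nodup hp.support_nodup,
          Walk.length_support, hlen])
      rw [← this] at hD
      simpa using hD
  -- Without edges, `W` is its own only dominating set.
  · push Not at h
    exact ⟨[W], by simp, by simp, by simp, fun S => by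
      rw [mem_dominatingSetsOn_of_forall_not_adj h, List.mem_singleton]⟩

end SimpleGraph

theorem mainTheorem9 {V : Type*} [Finite V] (F : SimpleGraph V) (hF : F.IsAcyclic) :
    F.tarsGraph.IsPancyclic := by
  intro n hn hn'
  have hX : F.dominatingSetsOn Set.univ = {S | F.IsDominatingSet S} :=
    Set.ext fun _ => SimpleGraph.mem_dominatingSetsOn_univ
  have hcard : Nat.card {S : Set V // F.IsDominatingSet S} =
      (F.dominatingSetsOn Set.univ).ncard := by
    rw [hX]
    rfl
  rw [hcard] at hn'
  by_cases h : ∃ a c, F.Adj a c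
  · obtain ⟨a, c, hac⟩ := h
    obtain ⟨u, v, huv⟩ := hF.exists_isLeafOn (Set.mem_univ a) (Set.mem_univ c) hac
    obtain ⟨L, hnd, hch, hodd, hL⟩ := hF.exists_hamiltonian_list (Set.univ \ {u, v})
    obtain ⟨S, T, hST, p, hp, hlen, hpW⟩ :=
      huv.exists_hasPathOn hF hnd hch hodd hL (by omega) hn'
    rw [hX] at hpW
    have hcyc : (SimpleGraph.Walk.cons hST.symm p).IsCycle := by
      rw [SimpleGraph.Walk.cons_isCycle_iff]
      -- If the closing edge lay on the path, the path would have length one, but `n ≥ 3`.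
      refine ⟨hp, fun hmem => ?_⟩
      rw [Sym2.eq_swap] at hmem
      have := hp.length_eq_one_of_mem_edges hmem
      omega
    have hsupp : ∀ D ∈ (SimpleGraph.Walk.cons hST.symm p).support, D ∈ {S | F.IsDominatingSet S} := by
      intro D hD
      rw [SimpleGraph.Walk.support_cons, List.mem_cons] at hD
      rcases hD with rfl | hD
      exacts [hpW _ p.end_mem_support, hpW _ hD]
    -- The cycle is carried from `tokenGraph` to `tarsGraph` through the induced subgraph on
    -- dominating sets.
    let φ : F.tokenGraph.induce {S | F.IsDominatingSet S} →g F.tarsGraph :=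
      ⟨fun S => ⟨S.1, S.2⟩, fun h => h⟩
    have hφ : Function.Injective φ := fun S T h => Subtype.ext (congrArg Subtype.val h)
    have hmap := (SimpleGraph.Walk.cons hST.symm p).map_induce hsupp
    have hcyc' : ((SimpleGraph.Walk.cons hST.symm p).induce _ hsupp).IsCycle := by
      rw [← hmap] at hcyc
      exact (SimpleGraph.Walk.isCycle_map_iff_of_injective Subtype.val_injective).1 hcyc
    have hlen' : ((SimpleGraph.Walk.cons hST.symm p).induce _ hsupp).length = n := by
      rw [← SimpleGraph.Walk.length_map, hmap]
      exact hlen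
    exact ⟨_, _, hcyc'.map hφ, by rw [SimpleGraph.Walk.length_map, hlen']⟩
  · push Not at h
    have : F.dominatingSetsOn Set.univ = {Set.univ} := Set.ext fun S =>
      SimpleGraph.mem_dominatingSetsOn_of_forall_not_adj fun a _ c _ => h a c
    rw [this, Set.ncard_singleton] at hn'
    omega
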